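/- Let $L$ be a co-Heyting algebra, i.e. a bounded lattice with an operation $a-b=\min\{c : a\le b\vee c\}$, and write $a\mathbin{\triangle} b=(a-b)\vee(b-a)$. The foundation rank of an element of an ordered set is defined by $\operatorname{rk}x\ge 0$ always, $\operatorname{rk}x\ge\beta+1$ iff $\operatorname{rk}y\ge\beta$ for some $y<x$, and, for limit $\alpha$, $\operatorname{rk}x\ge\alpha$ iff $\operatorname{rk}x\ge\beta$ for all $\beta<\alpha$ (it is $+\infty$ if $\operatorname{rk}x\ge\alpha$ for every ordinal $\alpha$); the cofoundation rank is the foundation rank for the reverse order. The codimension $\operatorname{codim}a$ of $a\in L$ is the minimum, over the prime filters $\mathfrak p$ of $L$ containing $a$, of the foundation rank of $\mathfrak p$ in the set of prime filters ordered by inclusion ($+\infty$ if there is no such $\mathfrak p$). For $d<\omega$ let $dL$ be the ideal $\{a\in L : \operatorname{codim}a\ge d\}$ and $L/dL$ the quotient of $L$ by the congruence $a\mathbin{\triangle} b\in dL$. The algebra $L$ is precompact if $L/dL$ is finite for every positive integer $d$, and Hausdorff if the topology of the pseudometric $\operatorname{dist}(a,b)=2^{-\operatorname{codim}(a\triangle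 b)}$ (read as $0$ when $\operatorname{codim}(a\mathbin{\triangle} b)\ge\omega$) is Hausdorff. Let $\widehat L=\varprojlim_d L/dL$, a co-Heyting algebra with the componentwise operations, and let $\iota:L\to\widehat L$ be the canonical morphism. An element $x\neq\mathbf 0$ is join irreducible if $x\le a\vee b$ implies $x\le a$ or $x\le b$, and completely join irreducible if, for every subset $A$ that has a join, $x\le\bigvee A$ implies $x\le a$ for some $a\in A$. Let $\mathcal I^{!\vee}(L)$ be the ordered set of completely join irreducible elements of $L$. The join irreducible components of $a$ are the maximal elements of the set of join irreducible elements $x\le a$. Suppose that $L$ is precompact and Hausdorff. Then: 1. $L$ and $\widehat L$ have the same completely join irreducible elements: $\iota$ is injective, and $\iota(\mathcal I^{!\vee}(L))=\mathcal I^{!\vee}(\widehat L)$. 2. Every join irreducible element of $L$ is completely join irreducible. 3. For every $x\in\mathcal I^{!\vee}(L)$, the cofoundation rank of $x$ in $\mathcal I^{!\vee}(L)$ is finite, and it is equal to $\operatorname{codim}x$. 4. $\mathcal I^{!\vee}(L)$ satisfies the ascending chain condition. 5. For every $a\in L$, the set of join irreducible components of $a$ has a join in $L$, and this join is $a$. 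-/

import Mathlib

open scoped symmDiff

universe u

/-! ### Foundation and cofoundation ranks -/

/-- `RankGE r α x` is the relation `rk x ≥ α` for the strict relation `r` (`r y x` means `y < x`):
`rk x ≥ 0` always, `rk x ≥ β + 1` iff some `y < x` has `rk y ≥ β`, and for a limit ordinal `α`,
`rk x ≥ α` iff `rk x ≥ β` for all `β < α`. -/
inductive RankGE {E : Type u} (r : E → E → Prop) : Ordinal.{u} → E → Prop
  | zero (x : E) : RankGE r 0 x
  | succ {β : Ordinal.{u}} {x y : E} (hyx : r y x) (hy : RankGE r β y) : RankGE r (β + 1) x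
  | limit {α : Ordinal.{u}} {x : E} (hα : Order.IsSuccLimit α)
      (h : ∀ β : Ordinal.{u}, β < α → RankGE r β x) : RankGE r α x

open Classical in
/-- The foundation rank of `x`: the ordinal `α` such that `rk x ≥ α` but not `rk x ≥ α + 1`,
and `⊤` (that is, `+∞`) if there is no such ordinal. -/
noncomputable def relRank {E : Type u} (r : E → E → Prop) (x : E) : WithTop Ordinal.{u} :=
  if h : ∃ α : Ordinal.{u}, RankGE r α x ∧ ¬ RankGE r (α + 1) x then (h.choose : Ordinal.{u}) else ⊤

/-- The foundation rank of `x` in the ordered set `E`. -/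
noncomputable def foundationRank {E : Type u} [PartialOrder E] (x : E) : WithTop Ordinal.{u} :=
  relRank (fun y z : E => y < z) x

/-- The cofoundation rank of `x` in the ordered set `E`: the foundation rank for the reverse
order. -/
noncomputable def cofoundationRank {E : Type u} [PartialOrder E] (x : E) : WithTop Ordinal.{u} :=
  relRank (fun y z : E => z < y) x

namespace CoHeyting

section Lattices

variable {L : Type u} [CoheytingAlgebra L]

/-! ### Prime filter spectrum and codimension -/

variable (L) in
/-- The prime filter spectrum, ordered by inclusion. -/
abbrev PrimeSpec : Type u := {p : Order.PFilter L // p.IsPrime}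

/-- The height of a prime filter: its foundation rank in the spectrum. -/
noncomputable def height (p : PrimeSpec L) : WithTop Ordinal.{u} := foundationRank p

/-- The codimension of `a`: the least height of a prime filter containing `a`
(`⊤` if there is none). -/
noncomputable def codim (a : L) : WithTop Ordinal.{u} :=
  sInf {h | ∃ p : PrimeSpec L, a ∈ p.1 ∧ height p = h}

theorem codim_anti {a b : L} (h : a ≤ b) : codim b ≤ codim a := by
  refine sInf_le_sInf ?_
  rintro _ ⟨p, hp, rfl⟩
  exact ⟨p, Order.PFilter.mem_of_le h hp, rfl⟩

theorem mem_or_mem_of_sup_mem (p : PrimeSpec L) {a b : L} (h : a ⊔ b ∈ p.1) :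
    a ∈ p.1 ∨ b ∈ p.1 := by
  by_contra hc
  rw [not_or] at hc
  obtain ⟨c, hc', hac, hbc⟩ := p.2.compl_ideal.Directed a hc.1 b hc.2
  exact hc' (Order.PFilter.mem_of_le (sup_le hac hbc) h)

theorem codim_sup (a b : L) : codim (a ⊔ b) = min (codim a) (codim b) := by
  refine le_antisymm (le_min (codim_anti le_sup_left) (codim_anti le_sup_right)) ?_
  refine le_sInf ?_
  rintro _ ⟨p, hp, rfl⟩
  rcases mem_or_mem_of_sup_mem p hp with h | h
  · exact (min_le_left _ _).trans (sInf_le ⟨p, h, rfl⟩)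
  · exact (min_le_right _ _).trans (sInf_le ⟨p, h, rfl⟩)

theorem codim_bot : codim (⊥ : L) = ⊤ := by
  refine top_le_iff.mp (le_sInf ?_)
  rintro _ ⟨p, hp, rfl⟩
  obtain ⟨c, hc⟩ := p.2.compl_ideal.Nonempty
  exact absurd (Order.PFilter.mem_of_le bot_le hp) hc

variable (L) in
/-- The ideal `dL` of the elements of codimension at least `d`. -/
noncomputable def codimIdeal (d : ℕ) : Order.Ideal L where
  carrier := {a | ((d : Ordinal.{u}) : WithTop Ordinal.{u}) ≤ codim a}
  lower' _ _ hba ha := le_trans ha (codim_anti hba)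
  nonempty' := ⟨⊥, by simp [codim_bot]⟩
  directed' a ha b hb := ⟨a ⊔ b, by
    show _ ≤ codim (a ⊔ b)
    rw [codim_sup]; exact le_min ha hb, le_sup_left, le_sup_right⟩

theorem codimIdeal_succ_le (d : ℕ) : codimIdeal L (d + 1) ≤ codimIdeal L d := by
  intro a ha
  refine le_trans ?_ (show _ ≤ codim a from ha)
  exact WithTop.coe_le_coe.mpr (by exact_mod_cast Nat.le_succ d)

/-! ### The codimetric pseudometric -/

open Classical in
/-- `2 ^ (-c)` if `c` is finite, and `0` otherwise. -/
noncomputable def twoPowNeg (c : WithTop Ordinal.{u}) : ℝ :=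
  if h : ∃ n : ℕ, c = ((n : Ordinal.{u}) : WithTop Ordinal.{u}) then (1 / 2 : ℝ) ^ h.choose else 0

theorem twoPowNeg_natCast (n : ℕ) :
    twoPowNeg ((n : Ordinal.{u}) : WithTop Ordinal.{u}) = (1 / 2 : ℝ) ^ n := by
  have h : ∃ m : ℕ, ((n : Ordinal.{u}) : WithTop Ordinal.{u})
      = ((m : Ordinal.{u}) : WithTop Ordinal.{u}) := ⟨n, rfl⟩
  have h2 : n = h.choose := by exact_mod_cast WithTop.coe_injective h.choose_spec
  rw [twoPowNeg, dif_pos h, ← h2]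

theorem twoPowNeg_nonneg (c : WithTop Ordinal.{u}) : 0 ≤ twoPowNeg c := by
  unfold twoPowNeg
  split_ifs <;> positivity

theorem twoPowNeg_anti {c c' : WithTop Ordinal.{u}} (h : c ≤ c') :
    twoPowNeg c' ≤ twoPowNeg c := by
  by_cases h' : ∃ n : ℕ, c' = ((n : Ordinal.{u}) : WithTop Ordinal.{u})
  · obtain ⟨n, rfl⟩ := h'
    obtain ⟨o, rfl⟩ := WithTop.ne_top_iff_exists.mp (ne_top_of_le_ne_top WithTop.coe_ne_top h)
    have ho : o ≤ (n : Ordinal.{u}) := WithTop.coe_le_coe.mp h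
    obtain ⟨m, rfl⟩ := Ordinal.lt_omega0.mp (lt_of_le_of_lt ho (Ordinal.natCast_lt_omega0 n))
    rw [twoPowNeg_natCast, twoPowNeg_natCast]
    exact pow_le_pow_of_le_one (by norm_num) (by norm_num) (by exact_mod_cast ho)
  · rw [twoPowNeg, dif_neg h']
    exact twoPowNeg_nonneg c

variable (L) in
/-- The pseudometric on `L` given by `d(a, b) = 2 ^ (-codim (a ∆ b))` if `codim (a ∆ b) < ω`
and `d(a, b) = 0` otherwise. Here `a ∆ b = (a \ b) ⊔ (b \ a)`. -/
@[reducible]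
noncomputable def codimPseudoMetric : PseudoMetricSpace L where
  dist a b := twoPowNeg (codim (a ∆ b))
  dist_self a := by
    show twoPowNeg (codim (a ∆ a)) = 0
    rw [symmDiff_self, codim_bot, twoPowNeg, dif_neg]
    rintro ⟨n, hn⟩
    exact WithTop.coe_ne_top hn.symm
  dist_comm a b := by
    show twoPowNeg (codim (a ∆ b)) = twoPowNeg (codim (b ∆ a))
    rw [symmDiff_comm]
  dist_triangle a b c := by
    show twoPowNeg (codim (a ∆ c)) ≤ twoPowNeg (codim (a ∆ b)) + twoPowNeg (codim (b ∆ c))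
    have h := twoPowNeg_anti (codim_anti (symmDiff_triangle a b c))
    rw [codim_sup] at h
    have h1 := twoPowNeg_nonneg (codim (a ∆ b))
    have h2 := twoPowNeg_nonneg (codim (b ∆ c))
    rcases min_choice (codim (a ∆ b)) (codim (b ∆ c)) with h3 | h3 <;> rw [h3] at h <;> linarith

variable (L) in
/-- `L` is Hausdorff if its codimetric topology is Hausdorff. -/
def IsHausdorff : Prop :=
  @T2Space L (codimPseudoMetric L).toUniformSpace.toTopologicalSpace

/-! ### Quotient by an ideal -/

/-- The congruence `a ≡ b` iff `a ∆ b ∈ I`. -/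
def idealSetoid (I : Order.Ideal L) : Setoid L where
  r a b := a ∆ b ∈ I
  iseqv :=
    { refl := fun a => by rw [symmDiff_self]; exact I.bot_mem
      symm := fun {a b} h => by rw [symmDiff_comm]; exact h
      trans := fun {a b c} h h' => I.lower (symmDiff_triangle a b c) (Order.Ideal.sup_mem h h') }

/-- The quotient `L/I`. -/
def IdealQuotient (I : Order.Ideal L) : Type u := Quotient (idealSetoid I)

variable (L) in
/-- `L` is precompact if `L/dL` is finite for every positive integer `d`. -/
def IsPrecompact : Prop := ∀ d : ℕ, 0 < d → Finite (IdealQuotient (codimIdeal L d))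

namespace IdealQuotient

variable {I J : Order.Ideal L}

/-- The canonical projection `L → L/I`. -/
def mk (I : Order.Ideal L) (a : L) : IdealQuotient I := Quotient.mk (idealSetoid I) a

theorem mk_eq_iff {a b : L} : mk I a = mk I b ↔ a ∆ b ∈ I :=
  ⟨fun h => Quotient.exact h, fun h => Quotient.sound h⟩

theorem mk_eq_iff_exists {a b : L} : mk I a = mk I b ↔ ∃ e ∈ I, a ≤ b ⊔ e ∧ b ≤ a ⊔ e := by
  rw [mk_eq_iff]
  constructor
  · intro h
    exact ⟨a ∆ b, h, symmDiff_le_iff.mp le_rfl⟩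
  · rintro ⟨e, he, h⟩
    exact I.lower (symmDiff_le_iff.mpr h) he

theorem symmDiff_mem_iff {a b : L} : a ∆ b ∈ I ↔ ∃ e ∈ I, a ≤ b ⊔ e ∧ b ≤ a ⊔ e := by
  rw [← mk_eq_iff, mk_eq_iff_exists]

theorem sup_congr_mem {a a' b b' : L} (h : a ∆ a' ∈ I) (h' : b ∆ b' ∈ I) :
    (a ⊔ b) ∆ (a' ⊔ b') ∈ I := by
  rw [symmDiff_mem_iff] at h h' ⊢
  obtain ⟨e, he, h1, h2⟩ := h
  obtain ⟨f, hf, h3, h4⟩ := h'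
  refine ⟨e ⊔ f, Order.Ideal.sup_mem he hf, ?_, ?_⟩
  · rw [sup_sup_sup_comm]; exact sup_le_sup h1 h3
  · rw [sup_sup_sup_comm]; exact sup_le_sup h2 h4

theorem inf_congr_mem {a a' b b' : L} (h : a ∆ a' ∈ I) (h' : b ∆ b' ∈ I) :
    (a ⊓ b) ∆ (a' ⊓ b') ∈ I := by
  rw [symmDiff_mem_iff] at h h' ⊢
  obtain ⟨e, he, h1, h2⟩ := h
  obtain ⟨f, hf, h3, h4⟩ := h'
  refine ⟨e ⊔ f, Order.Ideal.sup_mem he hf, ?_, ?_⟩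
  · rw [sup_inf_right]
    exact inf_le_inf (h1.trans (sup_le_sup le_rfl le_sup_left))
      (h3.trans (sup_le_sup le_rfl le_sup_right))
  · rw [sup_inf_right]
    exact inf_le_inf (h2.trans (sup_le_sup le_rfl le_sup_left))
      (h4.trans (sup_le_sup le_rfl le_sup_right))

theorem sdiff_le_aux {a a' b b' e f : L} (h1 : a ≤ a' ⊔ e) (h4 : b' ≤ b ⊔ f) :
    a \ b ≤ a' \ b' ⊔ (e ⊔ f) := by
  rw [sdiff_le_iff]
  have h : a' ≤ b' ⊔ a' \ b' := le_sup_sdiff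
  refine h1.trans (sup_le (h.trans (sup_le (h4.trans ?_) ?_)) ?_)
  · exact sup_le le_sup_left (le_sup_right.trans (le_sup_right.trans le_sup_right))
  · exact le_sup_left.trans le_sup_right
  · exact le_sup_left.trans (le_sup_right.trans le_sup_right)

theorem sdiff_congr_mem {a a' b b' : L} (h : a ∆ a' ∈ I) (h' : b ∆ b' ∈ I) :
    (a \ b) ∆ (a' \ b') ∈ I := by
  rw [symmDiff_mem_iff] at h h' ⊢
  obtain ⟨e, he, h1, h2⟩ := h
  obtain ⟨f, hf, h3, h4⟩ := h'
  exact ⟨e ⊔ f, Order.Ideal.sup_mem he hf, sdiff_le_aux h1 h4, sdiff_le_aux h2 h3⟩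

/-- The join of `L/I`, induced by that of `L`. -/
protected def sup : IdealQuotient I → IdealQuotient I → IdealQuotient I :=
  Quotient.map₂ (· ⊔ ·) fun _ _ h _ _ h' => sup_congr_mem h h'

/-- The meet of `L/I`, induced by that of `L`. -/
protected def inf : IdealQuotient I → IdealQuotient I → IdealQuotient I :=
  Quotient.map₂ (· ⊓ ·) fun _ _ h _ _ h' => inf_congr_mem h h'

/-- The difference of `L/I`, induced by that of `L`. -/
protected def sdiff : IdealQuotient I → IdealQuotient I → IdealQuotient I :=
  Quotient.map₂ (· \ ·) fun _ _ h _ _ h' => sdiff_congr_mem h h'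

/-- The order of `L/I`: `x ≤ y` iff `x ⊔ y = y`. -/
instance : LE (IdealQuotient I) := ⟨fun x y => IdealQuotient.sup x y = y⟩

theorem mk_le_mk_iff {a b : L} : mk I a ≤ mk I b ↔ ∃ e ∈ I, a ≤ b ⊔ e := by
  show mk I (a ⊔ b) = mk I b ↔ _
  rw [mk_eq_iff_exists]
  constructor
  · rintro ⟨e, he, h, _⟩
    exact ⟨e, he, le_sup_left.trans h⟩
  · rintro ⟨e, he, h⟩
    exact ⟨e, he, sup_le h le_sup_left, le_sup_right.trans le_sup_left⟩

theorem mk_le_mk {a b : L} (h : a ≤ b) : mk I a ≤ mk I b :=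
  mk_le_mk_iff.mpr ⟨⊥, I.bot_mem, h.trans le_sup_left⟩

/-- The co-Heyting algebra structure of `L/I` which makes the projection a morphism. -/
instance : CoheytingAlgebra (IdealQuotient I) where
  le_refl := by
    rintro ⟨a⟩
    exact mk_le_mk le_rfl
  le_trans := by
    rintro ⟨a⟩ ⟨b⟩ ⟨c⟩ h h'
    obtain ⟨e, he, h⟩ := mk_le_mk_iff.mp h
    obtain ⟨f, hf, h'⟩ := mk_le_mk_iff.mp h'
    refine mk_le_mk_iff.mpr ⟨f ⊔ e, Order.Ideal.sup_mem hf he, h.trans ?_⟩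
    rw [← sup_assoc]
    exact sup_le_sup h' le_rfl
  le_antisymm := by
    rintro ⟨a⟩ ⟨b⟩ h h'
    obtain ⟨e, he, h⟩ := mk_le_mk_iff.mp h
    obtain ⟨f, hf, h'⟩ := mk_le_mk_iff.mp h'
    exact mk_eq_iff_exists.mpr ⟨e ⊔ f, Order.Ideal.sup_mem he hf,
      h.trans (sup_le_sup le_rfl le_sup_left), h'.trans (sup_le_sup le_rfl le_sup_right)⟩
  sup := IdealQuotient.sup
  inf := IdealQuotient.inf
  le_sup_left := by
    rintro ⟨a⟩ ⟨b⟩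
    exact mk_le_mk le_sup_left
  le_sup_right := by
    rintro ⟨a⟩ ⟨b⟩
    exact mk_le_mk le_sup_right
  sup_le := by
    rintro ⟨a⟩ ⟨b⟩ ⟨c⟩ h h'
    obtain ⟨e, he, h⟩ := mk_le_mk_iff.mp h
    obtain ⟨f, hf, h'⟩ := mk_le_mk_iff.mp h'
    exact mk_le_mk_iff.mpr ⟨e ⊔ f, Order.Ideal.sup_mem he hf,
      sup_le (h.trans (sup_le_sup le_rfl le_sup_left)) (h'.trans (sup_le_sup le_rfl le_sup_right))⟩
  inf_le_left := by
    rintro ⟨a⟩ ⟨b⟩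
    exact mk_le_mk inf_le_left
  inf_le_right := by
    rintro ⟨a⟩ ⟨b⟩
    exact mk_le_mk inf_le_right
  le_inf := by
    rintro ⟨a⟩ ⟨b⟩ ⟨c⟩ h h'
    obtain ⟨e, he, h⟩ := mk_le_mk_iff.mp h
    obtain ⟨f, hf, h'⟩ := mk_le_mk_iff.mp h'
    refine mk_le_mk_iff.mpr ⟨e ⊔ f, Order.Ideal.sup_mem he hf, ?_⟩
    rw [sup_inf_right]
    exact le_inf (h.trans (sup_le_sup le_rfl le_sup_left))
      (h'.trans (sup_le_sup le_rfl le_sup_right))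
  bot := mk I ⊥
  bot_le := by
    rintro ⟨a⟩
    exact mk_le_mk bot_le
  top := mk I ⊤
  le_top := by
    rintro ⟨a⟩
    exact mk_le_mk le_top
  sdiff := IdealQuotient.sdiff
  sdiff_le_iff := by
    rintro ⟨a⟩ ⟨b⟩ ⟨c⟩
    show mk I (a \ b) ≤ mk I c ↔ mk I a ≤ mk I (b ⊔ c)
    simp only [mk_le_mk_iff, sdiff_le_iff, sup_assoc]
  hnot x := IdealQuotient.sdiff (mk I ⊤) x
  top_sdiff _ := rfl

/-- The canonical projection `L/I → L/J` for `I ≤ J`. -/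
def factor (h : I ≤ J) : IdealQuotient I → IdealQuotient J :=
  Quotient.map id fun _ _ hab => h hab

theorem factor_mk (h : I ≤ J) (a : L) : factor h (mk I a) = mk J a := rfl

theorem factor_sup (h : I ≤ J) (x y : IdealQuotient I) :
    factor h (x ⊔ y) = factor h x ⊔ factor h y := by
  induction x using Quotient.inductionOn
  induction y using Quotient.inductionOn
  rfl

theorem factor_inf (h : I ≤ J) (x y : IdealQuotient I) :
    factor h (x ⊓ y) = factor h x ⊓ factor h y := by
  induction x using Quotient.inductionOn
  induction y using Quotient.inductionOn
  rfl

theorem factor_sdiff (h : I ≤ J) (x y : IdealQuotient I) :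
    factor h (x \ y) = factor h x \ factor h y := by
  induction x using Quotient.inductionOn
  induction y using Quotient.inductionOn
  rfl

end IdealQuotient

/-! ### The completion -/

variable (L) in
/-- The completion of `L`: the projective limit of the quotients `L/dL`, `d < ω`. -/
def Completion : Type u :=
  {x : ∀ d : ℕ, IdealQuotient (codimIdeal L d) //
    ∀ d : ℕ, IdealQuotient.factor (codimIdeal_succ_le d) (x (d + 1)) = x d}

namespace Completion

open IdealQuotient

/-- The componentwise order. -/
noncomputable instance : PartialOrder (Completion L) := Subtype.partialOrder _

/-- The completion is a co-Heyting algebra for the componentwise operations. -/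
noncomputable instance : CoheytingAlgebra (Completion L) where
  sup x y := ⟨fun d => x.1 d ⊔ y.1 d, fun d => by rw [factor_sup, x.2, y.2]⟩
  inf x y := ⟨fun d => x.1 d ⊓ y.1 d, fun d => by rw [factor_inf, x.2, y.2]⟩
  le_sup_left _ _ _ := le_sup_left
  le_sup_right _ _ _ := le_sup_right
  sup_le _ _ _ h h' d := sup_le (h d) (h' d)
  inf_le_left _ _ _ := inf_le_left
  inf_le_right _ _ _ := inf_le_right
  le_inf _ _ _ h h' d := le_inf (h d) (h' d)
  bot := ⟨fun _ => ⊥, fun _ => rfl⟩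
  bot_le _ _ := bot_le
  top := ⟨fun _ => ⊤, fun _ => rfl⟩
  le_top _ _ := le_top
  sdiff x y := ⟨fun d => x.1 d \ y.1 d, fun d => by rw [factor_sdiff, x.2, y.2]⟩
  sdiff_le_iff _ _ _ := forall_congr' fun _ => sdiff_le_iff
  hnot x := ⟨fun d => ⊤ \ x.1 d, fun d => by rw [factor_sdiff, x.2]; rfl⟩
  top_sdiff _ := rfl

variable (L) in
/-- The canonical morphism of co-Heyting algebras from `L` to its completion,
`a ↦ (a mod dL)_d`. -/
noncomputable def of : CoheytingHom L (Completion L) where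
  toFun a := ⟨fun d => mk (codimIdeal L d) a, fun _ => rfl⟩
  map_sup' _ _ := rfl
  map_inf' _ _ := rfl
  map_top' := rfl
  map_sdiff' _ _ := rfl

end Completion

/-! ### Join irreducible elements -/

/-- Join irreducible elements. -/
def JoinIrreducible (x : L) : Prop :=
  x ≠ ⊥ ∧ ∀ a b : L, x ≤ a ⊔ b → x ≤ a ∨ x ≤ b

/-- Completely join irreducible elements; the condition ranges over the subsets of `L` which have
a join in `L`. -/
def CompletelyJoinIrreducible (x : L) : Prop :=
  x ≠ ⊥ ∧ ∀ (A : Set L) (s : L), IsLUB A s → x ≤ s → ∃ a ∈ A, x ≤ a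

variable (L) in
/-- The ordered set of the completely join irreducible elements of `L`. -/
abbrev CJI : Type u := {x : L // CompletelyJoinIrreducible x}

/-- The join irreducible components of `a`: the maximal join irreducible elements below `a`. -/
def joinIrreducibleComponents (a : L) : Set L :=
  {x | Maximal (fun y : L => JoinIrreducible y ∧ y ≤ a) x}

end Lattices

end CoHeyting

/-! ### Ranks -/

/-! The proof is a duality between join irreducible elements and prime filters of finite height. By
`exists_le_of_sdiff_mem`, the order of `L/dL` depends only on the prime filters of height `< d`.
Precompactness makes these finitely many for each `d`, and the Hausdorff property says that the
prime filters of finite height separate the points of `L`.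

Let `p` have finite height. Finiteness gives an element `b` lying in exactly those `q` of finite
height with `¬ q ≤ p`, then a meet `c` of such elements over all filters strictly below `p`; the
element `c \ b` lies in exactly those `q` with `p ≤ q`. By separation it generates `p`, so `p` is
principal with a join irreducible generator `x`. Conversely, a join irreducible element generates a
prime filter of finite height. Moreover `b` is the greatest element not above `x`, which forces
complete join irreducibility.

Inclusion of principal filters reverses the order of generators, so cofoundation rank, height and
codimension agree. Finite ranks give the chain condition, hence the components. An element of the
completion is determined by the join irreducible elements of `L` below it, so the splitting pairs
`(x, b)` survive there. -/

namespace RankGE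

variable {E : Type u} {r : E → E → Prop} {α β : Ordinal.{u}} {x y : E}

theorem of_forall (h : ∀ β < α, ∃ y, r y x ∧ RankGE r β y) : RankGE r α x := by
  induction α using Ordinal.limitRecOn with
  | zero => exact .zero x
  | add_one β _ =>
    obtain ⟨y, hyx, hy⟩ := h β (lt_add_one β)
    exact .succ hyx hy
  | limit α hα ih => exact .limit hα fun β hβ => ih β hβ fun γ hγ => h γ (hγ.trans hβ)

theorem mono_left (h : RankGE r α x) : ∀ {β}, β ≤ α → RankGE r β x := by
  induction h with
  | zero x =>
    intro β hβ
    obtain rfl : β = 0 := le_antisymm hβ zero_le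
    exact .zero x
  | @succ γ x y hyx _ ih =>
    intro β hβ
    exact of_forall fun δ hδ => ⟨y, hyx, ih (Order.lt_add_one_iff.mp (hδ.trans_le hβ))⟩
  | limit hα h ih =>
    intro β hβ
    rcases hβ.eq_or_lt with rfl | hβ
    · exact .limit hα h
    · exact h β hβ

theorem add_one_iff : RankGE r (α + 1) x ↔ ∃ y, r y x ∧ RankGE r α y := by
  refine ⟨fun h => ?_, fun ⟨y, hyx, hy⟩ => .succ hyx hy⟩
  generalize hβ : α + 1 = β at h
  cases h with
  | zero => exact absurd hβ (by simp)
  | succ hyx hy =>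
    obtain rfl := Order.succ_injective (α := Ordinal.{u}) hβ
    exact ⟨_, hyx, hy⟩
  | limit hα _ =>
    subst hβ
    exact absurd hα (by rw [← Order.succ_eq_add_one]; exact Order.not_isSuccLimit_succ α)

theorem natCast_succ_iff {n : ℕ} :
    RankGE r ((n + 1 : ℕ) : Ordinal.{u}) x ↔ ∃ y, r y x ∧ RankGE r (n : Ordinal.{u}) y := by
  rw [Nat.cast_add_one, add_one_iff]

theorem natCast_zero : RankGE r ((0 : ℕ) : Ordinal.{u}) x := by
  rw [Nat.cast_zero]
  exact .zero x

theorem natCast_mono {m n : ℕ} (hmn : m ≤ n) (h : RankGE r (n : Ordinal.{u}) x) :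
    RankGE r (m : Ordinal.{u}) x :=
  h.mono_left (by exact_mod_cast hmn)

theorem acc_of_not {n : ℕ} (h : ¬ RankGE r (n : Ordinal.{u}) x) : Acc r x := by
  induction n generalizing x with
  | zero => exact absurd natCast_zero h
  | succ n ih => exact .intro x fun y hyx => ih fun hy => h (natCast_succ_iff.mpr ⟨y, hyx, hy⟩)

theorem mono_right {E : Type u} [PartialOrder E] {α : Ordinal.{u}} {x y : E}
    (h : RankGE (fun y z : E => y < z) α x) (hxy : x ≤ y) :
    RankGE (fun y z : E => y < z) α y := by
  induction h with
  | zero x => exact .zero y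
  | succ hyx hy _ => exact .succ (lt_of_lt_of_le hyx hxy) hy
  | limit hα _ ih => exact .limit hα fun β hβ => ih β hβ hxy

/-- A finite rank takes every smaller value below the point: descend until the rank is exactly `n`.
The bound `m` only makes the descent stop. -/
theorem exists_le_natCast {E : Type u} [PartialOrder E] {m n : ℕ} {x : E}
    (h : RankGE (fun y z : E => y < z) (n : Ordinal.{u}) x)
    (hm : ¬ RankGE (fun y z : E => y < z) (m : Ordinal.{u}) x) :
    ∃ y ≤ x, RankGE (fun y z : E => y < z) (n : Ordinal.{u}) y ∧
      ¬ RankGE (fun y z : E => y < z) ((n + 1 : ℕ) : Ordinal.{u}) y := by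
  induction m generalizing x with
  | zero => exact absurd natCast_zero hm
  | succ m ih =>
    by_cases hn : RankGE (fun y z : E => y < z) ((n + 1 : ℕ) : Ordinal.{u}) x
    · obtain ⟨y, hyx, hy⟩ := natCast_succ_iff.mp hn
      obtain ⟨z, hzy, hz⟩ := ih hy fun hy' => hm (natCast_succ_iff.mpr ⟨y, hyx, hy'⟩)
      exact ⟨z, hzy.trans hyx.le, hz⟩
    · exact ⟨x, le_rfl, h, hn⟩

end RankGE

section relRank

variable {E : Type u} {r : E → E → Prop} {α : Ordinal.{u}} {x : E}

theorem coe_le_relRank_iff : (α : WithTop Ordinal.{u}) ≤ relRank r x ↔ RankGE r α x := by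
  unfold relRank
  split_ifs with h
  · rw [WithTop.coe_le_coe]
    refine ⟨h.choose_spec.1.mono_left, fun hα => not_lt.mp fun hlt => ?_⟩
    exact h.choose_spec.2 (hα.mono_left (Order.add_one_le_iff.mpr hlt))
  · push Not at h
    refine ⟨fun _ => ?_, fun _ => le_top⟩
    induction α using Ordinal.limitRecOn with
    | zero => exact .zero x
    | add_one β ih => exact h β (ih le_top)
    | limit α hα ih => exact .limit hα fun β hβ => ih β hβ le_top

theorem relRank_eq_coe (h : RankGE r α x) (h' : ¬ RankGE r (α + 1) x) :
    relRank r x = (α : WithTop Ordinal.{u}) := by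
  refine le_antisymm ?_ (coe_le_relRank_iff.mpr h)
  rw [← coe_le_relRank_iff, not_le] at h'
  obtain ⟨β, hβ⟩ := WithTop.ne_top_iff_exists.mp h'.ne_top
  rw [← hβ] at h' ⊢
  exact WithTop.coe_le_coe.mpr (Order.lt_add_one_iff.mp (WithTop.coe_lt_coe.mp h'))

theorem relRank_eq_natCast {n : ℕ} (h : RankGE r (n : Ordinal.{u}) x)
    (h' : ¬ RankGE r ((n + 1 : ℕ) : Ordinal.{u}) x) :
    relRank r x = ((n : Ordinal.{u}) : WithTop Ordinal.{u}) :=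
  relRank_eq_coe h (by rwa [← Nat.cast_add_one])

end relRank

namespace CoHeyting

variable {L : Type u} [CoheytingAlgebra L]

/-! ### Prime filters -/

/-- The filter of `a` misses the ideal generated by `b` and the complement of `p`, since `a ≤ j ⊔ b`
with `j ∉ p` would give `a \ b ≤ j`. The complement of a prime ideal separating the two is the
required `q`. -/
theorem exists_le_of_sdiff_mem {p : PrimeSpec L} {a b : L} (h : a \ b ∈ p.1) :
    ∃ q ≤ p, a ∈ q.1 ∧ b ∉ q.1 := by
  obtain ⟨J, hJ, hIJ, hFJ⟩ := DistribLattice.prime_ideal_of_disjoint_filter_ideal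
    (F := Order.PFilter.principal a)
    (I := p.2.compl_ideal.toIdeal ⊔ Order.Ideal.principal b) (by
      rw [Set.disjoint_left]
      intro c hac hc
      obtain ⟨j, hj, hcj⟩ := (Lattice.mem_ideal_sup_principal _ _ _).mp hc
      refine hj (Order.PFilter.mem_of_le ?_ h)
      rw [sdiff_le_iff, sup_comm]
      exact le_trans hac hcj)
  refine ⟨⟨hJ.toPrimePair.F, hJ.toPrimePair.F_isPrime⟩, ?_, ?_, ?_⟩
  · intro c hc
    by_contra hcp
    exact hc (hIJ ((le_sup_left : _ ≤ p.2.compl_ideal.toIdeal ⊔ Order.Ideal.principal b) hcp))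
  · exact Set.disjoint_left.mp hFJ (Order.PFilter.mem_principal.mpr le_rfl)
  · exact fun hb => hb (hIJ ((le_sup_right :
      _ ≤ p.2.compl_ideal.toIdeal ⊔ Order.Ideal.principal b) (Order.Ideal.mem_principal.mpr le_rfl)))

theorem sdiff_mem {p : PrimeSpec L} {a b : L} (ha : a ∈ p.1) (hb : b ∉ p.1) : a \ b ∈ p.1 :=
  (mem_or_mem_of_sup_mem p (Order.PFilter.mem_of_le (le_sup_sdiff (a := b)) ha)).resolve_left hb

theorem bot_notMem (p : PrimeSpec L) : ⊥ ∉ p.1 := fun h => by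
  obtain ⟨c, hc⟩ := p.2.compl_ideal.Nonempty
  exact hc (Order.PFilter.mem_of_le bot_le h)

theorem exists_notMem_forall_mem (p : PrimeSpec L) {S : Set (PrimeSpec L)} (hS : S.Finite)
    (h : ∀ q ∈ S, ¬ q ≤ p) : ∃ b, b ∉ p.1 ∧ ∀ q ∈ S, b ∈ q.1 := by
  induction S, hS using Set.Finite.induction_on with
  | empty => exact ⟨⊥, bot_notMem p, by simp⟩
  | @insert q S _ _ ih =>
    obtain ⟨b, hb, hbS⟩ := ih fun q hq => h q (Set.mem_insert_of_mem _ hq)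
    obtain ⟨c, hcq, hcp⟩ := SetLike.not_le_iff_exists.mp
      (show ¬ q.1 ≤ p.1 from h q (Set.mem_insert _ _))
    refine ⟨c ⊔ b, fun hm => (mem_or_mem_of_sup_mem p hm).elim hcp hb, ?_⟩
    rintro q' (rfl | hq')
    · exact Order.PFilter.mem_of_le le_sup_left hcq
    · exact Order.PFilter.mem_of_le le_sup_right (hbS q' hq')

/-- The height of `p` is at least `n`. -/
abbrev HeightGE (n : ℕ) (p : PrimeSpec L) : Prop :=
  RankGE (fun y z : PrimeSpec L => y < z) (n : Ordinal.{u}) p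

theorem mem_codimIdeal_iff {d : ℕ} {a : L} :
    a ∈ codimIdeal L d ↔ ∀ p : PrimeSpec L, a ∈ p.1 → HeightGE d p := by
  show _ ≤ codim a ↔ _
  rw [codim, le_sInf_iff]
  constructor
  · exact fun h p hp => coe_le_relRank_iff.mp (h _ ⟨p, hp, rfl⟩)
  · rintro h _ ⟨p, hp, rfl⟩
    exact coe_le_relRank_iff.mpr (h p hp)

open IdealQuotient

theorem mk_codimIdeal_le_iff {d : ℕ} {a b : L} :
    mk (codimIdeal L d) a ≤ mk (codimIdeal L d) b ↔
      ∀ p : PrimeSpec L, ¬ HeightGE d p → a ∈ p.1 → b ∈ p.1 := by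
  rw [mk_le_mk_iff]
  constructor
  · rintro ⟨e, he, hab⟩ p hp ha
    exact (mem_or_mem_of_sup_mem p (Order.PFilter.mem_of_le hab ha)).resolve_right
      fun hep => hp (mem_codimIdeal_iff.mp he p hep)
  · refine fun h => ⟨a \ b, mem_codimIdeal_iff.mpr fun p hp => ?_, le_sup_sdiff⟩
    by_contra hd
    -- Passing to a smaller filter keeps the height below `d`, so the hypothesis applies to `q`.
    obtain ⟨q, hqp, ha, hb⟩ := exists_le_of_sdiff_mem hp
    exact hb (h q (fun hq => hd (hq.mono_right hqp)) ha)

/-- A prime filter of height `< d` is recovered from its image in `L/dL`, and a finite set has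
finitely many subsets. -/
theorem finite_not_heightGE (hpre : IsPrecompact L) (d : ℕ) :
    {p : PrimeSpec L | ¬ HeightGE d p}.Finite := by
  rcases d.eq_zero_or_pos with rfl | hd
  · convert Set.finite_empty
    exact Set.eq_empty_of_forall_notMem fun p hp => hp RankGE.natCast_zero
  have := hpre d hd
  refine Set.Finite.of_finite_image (f := fun p => mk (codimIdeal L d) '' (p.1 : Set L))
    (Set.toFinite _) ?_
  have key : ∀ p q : PrimeSpec L, ¬ HeightGE d q →
      mk (codimIdeal L d) '' (p.1 : Set L) = mk (codimIdeal L d) '' (q.1 : Set L) → p ≤ q := by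
    intro p q hq h a ha
    obtain ⟨b, hb, hba⟩ := h.subset ⟨a, ha, rfl⟩
    exact mk_codimIdeal_le_iff.mp hba.le q hq hb
  exact fun p hp q hq h => le_antisymm (key p q hq h) (key q p hp h.symm)

/-- If no prime filter of finite height separates `a` from `b`, then `a \ b` lies in every `dL`,
hence at distance zero from `⊥`. -/
theorem le_iff_forall_mem (hhaus : IsHausdorff L) {a b : L} :
    a ≤ b ↔ ∀ (p : PrimeSpec L) (d : ℕ), ¬ HeightGE d p → a ∈ p.1 → b ∈ p.1 := by
  refine ⟨fun h p _ _ => Order.PFilter.mem_of_le h, fun h => ?_⟩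
  rw [← sdiff_eq_bot_iff]
  let _ := codimPseudoMetric L
  have : T2Space L := hhaus
  have hdist : dist (a \ b) ⊥ = 0 := by
    show twoPowNeg (codim ((a \ b) ∆ ⊥)) = 0
    rw [symmDiff_bot, twoPowNeg, dif_neg]
    rintro ⟨n, hn⟩
    have hmem : a \ b ∈ codimIdeal L (n + 1) := by
      refine mem_codimIdeal_iff.mpr fun p hp => ?_
      by_contra hd
      obtain ⟨q, hqp, ha, hb⟩ := exists_le_of_sdiff_mem hp
      exact hb (h q (n + 1) (fun hq => hd (hq.mono_right hqp)) ha)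
    have hle : (((n + 1 : ℕ) : Ordinal.{u}) : WithTop Ordinal.{u}) ≤ codim (a \ b) := hmem
    rw [hn, WithTop.coe_le_coe] at hle
    exact absurd (Nat.cast_le.mp hle) (by omega)
  exact (Metric.inseparable_iff.mpr hdist).eq

/-! ### Generators of the prime filters of finite height -/

theorem exists_mem_iff_not_le (hpre : IsPrecompact L) {p : PrimeSpec L} {n : ℕ}
    (hp : ¬ HeightGE n p) :
    ∃ b : L, ∀ (q : PrimeSpec L) (d : ℕ), ¬ HeightGE d q → (b ∈ q.1 ↔ ¬ q ≤ p) := by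
  -- Heights up to `n` suffice: a filter of larger finite height contains one of height exactly `n`,
  -- which is not below `p` because `p` has height `< n`.
  obtain ⟨b, hbp, hb⟩ := exists_notMem_forall_mem p
    (S := {q | ¬ HeightGE (n + 1) q ∧ ¬ q ≤ p})
    ((finite_not_heightGE hpre (n + 1)).subset fun q hq => hq.1) fun q hq => hq.2
  refine ⟨b, fun q d hq => ⟨fun hbq hqp => hbp (hqp hbq), fun hqp => ?_⟩⟩
  by_cases hn : HeightGE (n + 1) q
  · obtain ⟨r, hrq, hr, hr'⟩ := (hn.natCast_mono n.le_succ).exists_le_natCast hq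
    exact hrq (hb r ⟨hr', fun hrp => hp (hr.mono_right hrp)⟩)
  · exact hb q ⟨hn, hqp⟩

theorem exists_mem_iff_forall_not_le (hpre : IsPrecompact L) {n : ℕ} {S : Set (PrimeSpec L)}
    (hS : S.Finite) (h : ∀ p ∈ S, ¬ HeightGE n p) :
    ∃ c : L, ∀ (q : PrimeSpec L) (d : ℕ), ¬ HeightGE d q → (c ∈ q.1 ↔ ∀ p ∈ S, ¬ q ≤ p) := by
  induction S, hS using Set.Finite.induction_on with
  | empty => exact ⟨⊤, fun q _ _ => by simp [Order.PFilter.top_mem]⟩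
  | @insert p S _ _ ih =>
    obtain ⟨c, hc⟩ := ih fun q hq => h q (Set.mem_insert_of_mem _ hq)
    obtain ⟨b, hb⟩ := exists_mem_iff_not_le hpre (h p (Set.mem_insert _ _))
    refine ⟨b ⊓ c, fun q d hq => ?_⟩
    rw [Order.PFilter.inf_mem_iff, hb q d hq, hc q d hq, Set.forall_mem_insert]

theorem exists_mem_iff_ge (hpre : IsPrecompact L) {p : PrimeSpec L} {n : ℕ}
    (hp : ¬ HeightGE n p) :
    ∃ x : L, ∀ (q : PrimeSpec L) (d : ℕ), ¬ HeightGE d q → (x ∈ q.1 ↔ p ≤ q) := by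
  have hlt : ∀ q ∈ Set.Iio p, ¬ HeightGE n q := fun q hq h => hp (h.mono_right (le_of_lt hq))
  obtain ⟨b, hb⟩ := exists_mem_iff_not_le hpre hp
  obtain ⟨c, hc⟩ := exists_mem_iff_forall_not_le hpre
    ((finite_not_heightGE hpre n).subset hlt) hlt
  have hcp : c ∈ p.1 := (hc p n hp).mpr fun q hq hpq => absurd hq hpq.not_gt
  have hbp : b ∉ p.1 := fun h => (hb p n hp).mp h le_rfl
  -- A filter `r ≤ q` containing `c` but not `b` is below `p` and not below any filter strictly
  -- under `p`, so it is `p`.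
  refine ⟨c \ b, fun q d hq => ⟨fun h => ?_, fun h => h (sdiff_mem hcp hbp)⟩⟩
  obtain ⟨r, hrq, hcr, hbr⟩ := exists_le_of_sdiff_mem h
  have hr : ¬ HeightGE d r := fun hd => hq (hd.mono_right hrq)
  rw [hb r d hr, not_not] at hbr
  rw [hc r d hr] at hcr
  rcases hbr.eq_or_lt with rfl | hlt
  · exact hrq
  · exact absurd le_rfl (hcr r hlt)

theorem exists_mem_iff_le_of_isHausdorff (hpre : IsPrecompact L) (hhaus : IsHausdorff L)
    {p : PrimeSpec L} {n : ℕ} (hp : ¬ HeightGE n p) : ∃ x : L, ∀ a, a ∈ p.1 ↔ x ≤ a := by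
  obtain ⟨x, hx⟩ := exists_mem_iff_ge hpre hp
  refine ⟨x, fun a => ⟨fun ha => ?_, fun h =>
    Order.PFilter.mem_of_le h ((hx p n hp).mpr le_rfl)⟩⟩
  exact (le_iff_forall_mem hhaus).mpr fun q d hq hxq => (hx q d hq).mp hxq ha

/-! ### Join irreducible elements -/

theorem CompletelyJoinIrreducible.joinIrreducible {x : L} (hx : CompletelyJoinIrreducible x) :
    JoinIrreducible x := by
  refine ⟨hx.1, fun a b h => ?_⟩
  obtain ⟨c, rfl | rfl, hc⟩ := hx.2 {a, b} (a ⊔ b) isLUB_pair h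
  · exact .inl hc
  · exact .inr hc

/-- The prime filter generated by a join irreducible element. -/
def principalPrime (x : L) (hx : JoinIrreducible x) : PrimeSpec L :=
  ⟨Order.PFilter.principal x, ⟨{
    IsLowerSet := fun _ _ hba ha hb => ha (le_trans hb hba)
    Nonempty := ⟨⊥, fun h => hx.1 (le_bot_iff.mp h)⟩
    Directed := fun a ha b hb => ⟨a ⊔ b, fun h => (hx.2 a b h).elim ha hb,
      le_sup_left, le_sup_right⟩ }⟩⟩

theorem mem_principalPrime {x : L} {hx : JoinIrreducible x} {a : L} :
    a ∈ (principalPrime x hx).1 ↔ x ≤ a := Order.PFilter.mem_principal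

theorem principalPrime_le_iff {x : L} {hx : JoinIrreducible x} {p : PrimeSpec L} :
    principalPrime x hx ≤ p ↔ x ∈ p.1 := Order.PFilter.principal_le_iff

theorem principalPrime_lt_iff {x y : L} {hx : JoinIrreducible x} {hy : JoinIrreducible y} :
    principalPrime x hx < principalPrime y hy ↔ y < x := by
  rw [lt_iff_le_not_ge, lt_iff_le_not_ge, principalPrime_le_iff, principalPrime_le_iff,
    mem_principalPrime, mem_principalPrime]

theorem joinIrreducible_of_mem_iff {p : PrimeSpec L} {x : L} (h : ∀ a, a ∈ p.1 ↔ x ≤ a) :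
    JoinIrreducible x := by
  refine ⟨fun hx => bot_notMem p ((h ⊥).mpr hx.le), fun a b hab => ?_⟩
  rw [← h, ← h]
  exact mem_or_mem_of_sup_mem p ((h _).mpr hab)

theorem exists_eq_principalPrime (hpre : IsPrecompact L) (hhaus : IsHausdorff L)
    {p : PrimeSpec L} {n : ℕ} (hp : ¬ HeightGE n p) :
    ∃ (x : L) (hx : JoinIrreducible x), p = principalPrime x hx := by
  obtain ⟨x, hx⟩ := exists_mem_iff_le_of_isHausdorff hpre hhaus hp
  exact ⟨x, joinIrreducible_of_mem_iff hx, Subtype.ext (SetLike.ext hx)⟩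

/-- Every prime filter containing `x` contains the principal one. Were the latter of infinite
height, no prime filter of finite height would contain `x`, and separation would give `x = ⊥`. -/
theorem JoinIrreducible.exists_not_heightGE (hhaus : IsHausdorff L) {x : L}
    (hx : JoinIrreducible x) : ∃ n, ¬ HeightGE n (principalPrime x hx) := by
  by_contra! h
  refine hx.1 (le_bot_iff.mp ((le_iff_forall_mem hhaus).mpr fun p d hp hxp => ?_))
  exact absurd ((h d).mono_right (principalPrime_le_iff.mpr hxp)) hp

theorem JoinIrreducible.exists_le_iff_not_le (hpre : IsPrecompact L) (hhaus : IsHausdorff L)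
    {x : L} (hx : JoinIrreducible x) :
    ∃ b : L, ∀ a, a ≤ b ↔ ¬ x ≤ a := by
  obtain ⟨n, hn⟩ := hx.exists_not_heightGE hhaus
  obtain ⟨b, hb⟩ := exists_mem_iff_not_le hpre hn
  refine ⟨b, fun a => ⟨fun hab hxa => ?_, fun hxa => ?_⟩⟩
  · exact (hb _ n hn).mp (mem_principalPrime.mpr (hxa.trans hab)) le_rfl
  · refine (le_iff_forall_mem hhaus).mpr fun p d hp ha => (hb p d hp).mpr fun hle => ?_
    exact hxa (mem_principalPrime.mp (hle ha))

theorem JoinIrreducible.completelyJoinIrreducible (hpre : IsPrecompact L) (hhaus : IsHausdorff L)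
    {x : L} (hx : JoinIrreducible x) : CompletelyJoinIrreducible x := by
  refine ⟨hx.1, fun A s hs hxs => ?_⟩
  obtain ⟨b, hb⟩ := hx.exists_le_iff_not_le hpre hhaus
  by_contra! h
  exact (hb s).mp (hs.2 fun a ha => (hb a).mpr (h a ha)) hxs

theorem le_iff_forall_joinIrreducible (hpre : IsPrecompact L) (hhaus : IsHausdorff L) {a b : L} :
    a ≤ b ↔ ∀ x, JoinIrreducible x → x ≤ a → x ≤ b := by
  refine ⟨fun h x _ hxa => hxa.trans h, fun h => ?_⟩
  refine (le_iff_forall_mem hhaus).mpr fun p d hp ha => ?_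
  obtain ⟨x, hx, rfl⟩ := exists_eq_principalPrime hpre hhaus hp
  exact h x hx ha

theorem mk_codimIdeal_le_iff_forall_joinIrreducible (hpre : IsPrecompact L)
    (hhaus : IsHausdorff L) {d : ℕ} {a b : L} :
    mk (codimIdeal L d) a ≤ mk (codimIdeal L d) b ↔
      ∀ x (hx : JoinIrreducible x), ¬ HeightGE d (principalPrime x hx) → x ≤ a → x ≤ b := by
  rw [mk_codimIdeal_le_iff]
  refine ⟨fun h x hx hd => h _ hd, fun h p hp => ?_⟩
  obtain ⟨x, hx, rfl⟩ := exists_eq_principalPrime hpre hhaus hp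
  exact h x hx hp

/-! ### Cofoundation rank, height and codimension -/

theorem CJI.rankGE_iff_heightGE (hpre : IsPrecompact L) (hhaus : IsHausdorff L) {n : ℕ}
    {x : CJI L} :
    RankGE (fun y z : CJI L => z < y) (n : Ordinal.{u}) x ↔
      HeightGE n (principalPrime x.1 x.2.joinIrreducible) := by
  induction n generalizing x with
  | zero => exact ⟨fun _ => RankGE.natCast_zero, fun _ => RankGE.natCast_zero⟩
  | succ n ih =>
    rw [RankGE.natCast_succ_iff, HeightGE, RankGE.natCast_succ_iff]
    constructor
    · rintro ⟨y, hxy, hy⟩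
      exact ⟨_, principalPrime_lt_iff.mpr hxy, ih.mp hy⟩
    · rintro ⟨q, hqx, hq⟩
      -- A filter below one of finite height has finite height, so it is again principal.
      obtain ⟨m, hm⟩ := x.2.joinIrreducible.exists_not_heightGE hhaus
      obtain ⟨y, hy, rfl⟩ := exists_eq_principalPrime hpre hhaus
        fun h : HeightGE m q => hm (h.mono_right hqx.le)
      exact ⟨⟨y, hy.completelyJoinIrreducible hpre hhaus⟩, principalPrime_lt_iff.mp hqx, ih.mpr hq⟩

theorem CJI.wellFoundedGT (hpre : IsPrecompact L) (hhaus : IsHausdorff L) :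
    WellFoundedGT (CJI L) := by
  refine ⟨⟨fun x => ?_⟩⟩
  obtain ⟨n, hn⟩ := x.2.joinIrreducible.exists_not_heightGE hhaus
  exact RankGE.acc_of_not fun h => hn ((CJI.rankGE_iff_heightGE hpre hhaus).mp h)

theorem CJI.exists_cofoundationRank_eq (hpre : IsPrecompact L) (hhaus : IsHausdorff L)
    (x : CJI L) : ∃ n : ℕ, cofoundationRank x = ((n : Ordinal.{u}) : WithTop Ordinal.{u}) ∧
      codim (x : L) = ((n : Ordinal.{u}) : WithTop Ordinal.{u}) := by
  have hx := x.2.joinIrreducible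
  obtain ⟨n, hn, hn'⟩ : ∃ n, HeightGE n (principalPrime x.1 hx) ∧
      ¬ HeightGE (n + 1) (principalPrime x.1 hx) := by
    by_contra! h
    obtain ⟨n, hn⟩ := hx.exists_not_heightGE hhaus
    exact hn (Nat.rec RankGE.natCast_zero h n)
  refine ⟨n, relRank_eq_natCast ((CJI.rankGE_iff_heightGE hpre hhaus).mpr hn)
    fun h => hn' ((CJI.rankGE_iff_heightGE hpre hhaus).mp h), le_antisymm ?_ ?_⟩
  · rw [← relRank_eq_natCast hn hn']
    exact sInf_le ⟨_, mem_principalPrime.mpr le_rfl, rfl⟩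
  · exact mem_codimIdeal_iff.mpr fun p hp => hn.mono_right (principalPrime_le_iff.mpr hp)

/-! ### Join irreducible components -/

theorem exists_le_mem_joinIrreducibleComponents (hpre : IsPrecompact L) (hhaus : IsHausdorff L)
    {a x : L} (hx : JoinIrreducible x) (hxa : x ≤ a) :
    ∃ y ∈ joinIrreducibleComponents a, x ≤ y := by
  have := CJI.wellFoundedGT hpre hhaus
  obtain ⟨y, hxy, hy⟩ := exists_maximal_ge_of_wellFoundedGT (fun y : CJI L => (y : L) ≤ a)
    ⟨x, hx.completelyJoinIrreducible hpre hhaus⟩ hxa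
  exact ⟨y, ⟨⟨y.2.joinIrreducible, hy.1⟩, fun z hz hyz =>
    hy.2 (y := ⟨z, hz.1.completelyJoinIrreducible hpre hhaus⟩) hz.2 hyz⟩, hxy⟩

theorem isLUB_joinIrreducibleComponents (hpre : IsPrecompact L) (hhaus : IsHausdorff L) (a : L) :
    IsLUB (joinIrreducibleComponents a) a := by
  refine ⟨fun x hx => hx.1.2, fun b hb => ?_⟩
  refine (le_iff_forall_joinIrreducible hpre hhaus).mpr fun x hx hxa => ?_
  obtain ⟨y, hy, hxy⟩ := exists_le_mem_joinIrreducibleComponents hpre hhaus hx hxa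
  exact hxy.trans (hb hy)

/-! ### The completion -/

namespace Completion

theorem of_le_of_iff (hpre : IsPrecompact L) (hhaus : IsHausdorff L) {a b : L} :
    of L a ≤ of L b ↔ a ≤ b := by
  refine ⟨fun h => ?_, fun h d => mk_le_mk h⟩
  refine (le_iff_forall_joinIrreducible hpre hhaus).mpr fun x hx hxa => ?_
  obtain ⟨d, hd⟩ := hx.exists_not_heightGE hhaus
  exact (mk_codimIdeal_le_iff_forall_joinIrreducible hpre hhaus).mp (h d) x hx hd hxa

theorem of_injective (hpre : IsPrecompact L) (hhaus : IsHausdorff L) :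
    Function.Injective (of L) := fun _ _ h =>
  le_antisymm ((of_le_of_iff hpre hhaus).mp h.le) ((of_le_of_iff hpre hhaus).mp h.ge)

theorem val_eq_mk_of_le {y : Completion L} {a : L} {d e : ℕ} (hde : d ≤ e)
    (h : y.1 e = mk (codimIdeal L e) a) : y.1 d = mk (codimIdeal L d) a := by
  induction e, hde using Nat.le_induction with
  | base => exact h
  | succ e _ ih => exact ih (by rw [← y.2 e, h, factor_mk])

/-- Level `d` already decides whether `x` is below `y`: a representative `b` of a later component
satisfies `a ≤ b` modulo `dL`, and this forces `x ≤ b` in `L` itself. -/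
theorem of_le_of_le_mk (hpre : IsPrecompact L) (hhaus : IsHausdorff L) {y : Completion L}
    {x a : L} {d : ℕ} (hx : JoinIrreducible x) (hd : ¬ HeightGE d (principalPrime x hx))
    (hy : y.1 d = mk (codimIdeal L d) a) (hxa : x ≤ a) : of L x ≤ y := by
  intro e
  rcases le_total e d with hed | hde
  · rw [val_eq_mk_of_le hed hy]
    exact mk_le_mk hxa
  · obtain ⟨b, hb : mk (codimIdeal L e) b = y.1 e⟩ := Quotient.exists_rep (y.1 e)
    have hab : mk (codimIdeal L d) a ≤ mk (codimIdeal L d) b :=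
      (hy.symm.trans (val_eq_mk_of_le hde hb.symm)).le
    rw [← hb]
    exact mk_le_mk
      ((mk_codimIdeal_le_iff_forall_joinIrreducible hpre hhaus).mp hab x hx hd hxa)

theorem le_iff_forall_joinIrreducible (hpre : IsPrecompact L) (hhaus : IsHausdorff L)
    {y z : Completion L} :
    y ≤ z ↔ ∀ x, JoinIrreducible x → of L x ≤ y → of L x ≤ z := by
  refine ⟨fun h x _ hxy => hxy.trans h, fun h d => ?_⟩
  obtain ⟨a, ha : mk (codimIdeal L d) a = y.1 d⟩ := Quotient.exists_rep (y.1 d)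
  obtain ⟨b, hb : mk (codimIdeal L d) b = z.1 d⟩ := Quotient.exists_rep (z.1 d)
  rw [← ha, ← hb]
  refine (mk_codimIdeal_le_iff_forall_joinIrreducible hpre hhaus).mpr fun x hx hd hxa => ?_
  have hxz : mk (codimIdeal L d) x ≤ mk (codimIdeal L d) b :=
    (h x hx (of_le_of_le_mk hpre hhaus hx hd ha.symm hxa) d).trans hb.ge
  exact (mk_codimIdeal_le_iff_forall_joinIrreducible hpre hhaus).mp hxz x hx hd le_rfl

theorem image_completelyJoinIrreducible (hpre : IsPrecompact L) (hhaus : IsHausdorff L) :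
    of L '' {x : L | CompletelyJoinIrreducible x} =
      {y : Completion L | CompletelyJoinIrreducible y} := by
  ext y
  constructor
  · rintro ⟨x, hx, rfl⟩
    refine ⟨fun h => hx.1 (of_injective hpre hhaus (h.trans (map_bot (of L)).symm)), ?_⟩
    intro A s hs hxs
    obtain ⟨b, hb⟩ := hx.joinIrreducible.exists_le_iff_not_le hpre hhaus
    by_contra! h
    -- If no member of `A` is above the image of `x`, then the image of `b` bounds `A`, as can be
    -- tested on join irreducible elements of `L`; this gives the absurdity `x ≤ b`.
    refine (hb x).mp ((of_le_of_iff hpre hhaus).mp (hxs.trans (hs.2 fun a ha => ?_))) le_rfl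
    refine (le_iff_forall_joinIrreducible hpre hhaus).mpr fun z _ hza => ?_
    exact (of_le_of_iff hpre hhaus).mpr ((hb z).mpr fun hxz =>
      h a ha (((of_le_of_iff hpre hhaus).mpr hxz).trans hza))
  · intro hy
    -- `y` is the join of the images of join irreducible elements below it, so it equals one of
    -- them.
    obtain ⟨_, ⟨x, hx, hxy, rfl⟩, hyx⟩ := hy.2
      {z | ∃ x, JoinIrreducible x ∧ of L x ≤ y ∧ of L x = z} y
      ⟨by rintro _ ⟨x, _, hxy, rfl⟩; exact hxy, fun z hz =>
        (le_iff_forall_joinIrreducible hpre hhaus).mpr fun x hx hxy => hz ⟨x, hx, hxy, rfl⟩⟩ le_rfl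
    exact ⟨x, hx.completelyJoinIrreducible hpre hhaus, le_antisymm hxy hyx⟩

end Completion

end CoHeyting

/-- Let `L` be a precompact Hausdorff co-Heyting algebra, embedded in its completion through the
canonical morphism. Then `L` and its completion have the same completely join irreducible elements;
every join irreducible element of `L` is completely join irreducible; the cofoundation rank of a
completely join irreducible element among these is finite and is its codimension; the completely
join irreducible elements satisfy the ascending chain condition; every element is the complete join
of its join irreducible components. -/
theorem mainTheorem6 (L : Type u) [CoheytingAlgebra L]
    (hpre : CoHeyting.IsPrecompact L) (hhaus : CoHeyting.IsHausdorff L) :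
    (Function.Injective (CoHeyting.Completion.of L) ∧
      CoHeyting.Completion.of L '' {x : L | CoHeyting.CompletelyJoinIrreducible x} =
        {y : CoHeyting.Completion L | CoHeyting.CompletelyJoinIrreducible y}) ∧
    (∀ x : L, CoHeyting.JoinIrreducible x → CoHeyting.CompletelyJoinIrreducible x) ∧
    (∀ x : CoHeyting.CJI L, ∃ n : ℕ,
      cofoundationRank x = ((n : Ordinal.{u}) : WithTop Ordinal.{u}) ∧
      CoHeyting.codim (x : L) = ((n : Ordinal.{u}) : WithTop Ordinal.{u})) ∧
    WellFoundedGT (CoHeyting.CJI L) ∧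
    (∀ a : L, IsLUB (CoHeyting.joinIrreducibleComponents a) a) := by
  exact ⟨⟨CoHeyting.Completion.of_injective hpre hhaus,
    CoHeyting.Completion.image_completelyJoinIrreducible hpre hhaus⟩,
    fun _ hx => hx.completelyJoinIrreducible hpre hhaus,
    CoHeyting.CJI.exists_cofoundationRank_eq hpre hhaus,
    CoHeyting.CJI.wellFoundedGT hpre hhaus,
    CoHeyting.isLUB_joinIrreducibleComponents hpre hhaus⟩
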